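/- Let $n \ge 1$ and let $B^n$ be the closed Euclidean unit ball of $\mathbb{R}^n$. A convex body is a compact convex set with non-empty interior. For a real inner product space $V$ of finite dimension and $K, L \subseteq V$ put $$ d_{BM}(K,L) = \inf\{\rho > 0 : K+u \subseteq T(L+v) \subseteq \rho (K+u)\}, $$ where the infimum is over all such $\rho$ for which the inclusions hold for some invertible linear operator $T : V \to V$ and some vectors $u, v \in V$. An ellipsoid in $V$ is a set $c + T(B)$, where $B$ is the closed unit ball of $V$, $c \in V$, and $T : V \to V$ is linear and invertible. A pair of distance ellipsoids for $K \subseteq V$ is a pair $(E_1, E_2)$ of ellipsoids in $V$ with $E_1 \subseteq K \subseteq E_2$ and $E_2 = t + d_{BM}(K,B)\, E_1$ for some $t \in V$; the centers of $E_1$ and $E_2$ are arbitrary. Theorem. For every origin-symmetric convex body $K \subseteq \mathbb{R}^n$ (that is, $-K = K$), there is a linear subspace $U \subseteq \mathbb{R}^n$ (possibly $U = \mathbb{R}^n$) such that $$ d_{BM}(K\cap U, B^n \cap U) = d_{BM}(K, B^n), $$ where the left-hand side is taken relative to the space $V = U$, and such that there is exactly one pair of distance ellipsoids for $K \cap U$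 in $U$. -/

import Mathlib

open scoped Pointwise

/-- The Banach-Mazur distance `d_BM(K, L)` of two subsets `K`, `L` of a real normed space `V`:
the infimum of all `ρ > 0` such that `K + u ⊆ T (L + v) ⊆ ρ (K + u)` for some invertible linear
operator `T : V → V` and some vectors `u`, `v`. -/
noncomputable def banachMazurDist {V : Type*} [NormedAddCommGroup V] [NormedSpace ℝ V]
    (K L : Set V) : ℝ :=
  sInf {ρ : ℝ | 0 < ρ ∧ ∃ (T : V ≃ₗ[ℝ] V) (u v : V),
    (u +ᵥ K) ⊆ T '' (v +ᵥ L) ∧ T '' (v +ᵥ L) ⊆ ρ • (u +ᵥ K)}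

/-- The Euclidean (closed) unit ball of a real inner product space `V`. -/
def unitBall (V : Type*) [NormedAddCommGroup V] [InnerProductSpace ℝ V] : Set V :=
  Metric.closedBall 0 1

/-- The section `X ∩ U` of a set `X` by a linear subspace `U`, as a subset of the space `U`, so
that notions for `X ∩ U` are understood relative to `U`. -/
def subspaceSection {V : Type*} [NormedAddCommGroup V] [InnerProductSpace ℝ V]
    (X : Set V) (U : Submodule ℝ V) : Set U :=
  {x : U | (x : V) ∈ X}

/-- A (full-dimensional) ellipsoid in `V`, with arbitrary center `c`: the image of the Euclidean
unit ball under an invertible affine map. -/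
def IsEllipsoid {V : Type*} [NormedAddCommGroup V] [InnerProductSpace ℝ V] (E : Set V) : Prop :=
  ∃ (T : V ≃ₗ[ℝ] V) (c : V), E = c +ᵥ (T '' unitBall V)

/-- `(E₁, E₂)` is a pair of distance ellipsoids for `K` in `V`: both are ellipsoids, `E₂` is
homothetic to `E₁` with ratio `d_BM(K, B)`, where `B` is the Euclidean unit ball of `V`, and
`E₁ ⊆ K ⊆ E₂`. The centers of `E₁` and `E₂` are arbitrary. -/
def IsDistanceEllipsoidPair {V : Type*} [NormedAddCommGroup V] [InnerProductSpace ℝ V]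
    (K E₁ E₂ : Set V) : Prop :=
  IsEllipsoid E₁ ∧ IsEllipsoid E₂ ∧
    (∃ t : V, E₂ = t +ᵥ (banachMazurDist K (unitBall V) • E₁)) ∧ E₁ ⊆ K ∧ K ⊆ E₂

/-! A symmetric body `K` is the unit ball of a norm `p`, and a centered ellipsoid is given by a
positive definite form `Q`. The distance to the ball is therefore the least `ρ` with `p² ≤ Q ≤ ρ²
p²` for some `Q`; symmetrization shows that translations do not help
(`Seminorm.banachMazurDist_eq_ratio`).

Suppose two different forms are optimal. They can be combined into an optimal form `M` whose contact
points with both bounds lie in a subspace `U` on which the two forms agree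
(`Seminorm.Sandwiches.exists_mean`), so `U` is proper. If `p` had a smaller ratio on `U`, a better
form there, composed with the orthogonal projection, would improve `M` at all its contact points; by
compactness a small perturbation of `M` would then beat the optimum
(`Seminorm.Sandwiches.not_forall_contact`). Hence restriction to `U` keeps the ratio, and a subspace
of least dimension with the full ratio has exactly one optimal form. Uniqueness among centered
ellipsoids then forces all distance ellipsoids to be centered. -/

/-- The quadratic form `x ↦ ‖x‖²` of a real inner product space. -/
noncomputable def normSqForm (V : Type*) [NormedAddCommGroup V] [InnerProductSpace ℝ V] :
    QuadraticForm ℝ V :=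
  LinearMap.BilinMap.toQuadraticMap (innerₗ V)

@[simp]
theorem normSqForm_apply {V : Type*} [NormedAddCommGroup V] [InnerProductSpace ℝ V] (x : V) :
    normSqForm V x = ‖x‖ ^ 2 := by
  simp [normSqForm]

/-- A positive definite quadratic form on a Euclidean space is the square of the norm, up to a
linear change of coordinates. -/
theorem exists_linearEquiv_norm_sq {V : Type*} [NormedAddCommGroup V] [InnerProductSpace ℝ V]
    [FiniteDimensional ℝ V] (Q : QuadraticForm ℝ V) (hQ : ∀ x, x ≠ 0 → 0 < Q x) :
    ∃ T : V ≃ₗ[ℝ] V, ∀ x, Q x = ‖T x‖ ^ 2 := by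
  obtain ⟨w, hw, ⟨e⟩⟩ := Q.equivalent_one_zero_neg_one_weighted_sum_squared
  have hw1 : ∀ i, w i = 1 := by
    intro i
    have h1 : QuadraticMap.weightedSumSquares ℝ w (Pi.single i 1) = w i := by
      simp [QuadraticMap.weightedSumSquares_apply, Pi.single_apply]
    have h2 : 0 < Q (e.symm (Pi.single i 1)) := by
      apply hQ
      intro h
      have := congrArg e h
      simp only [QuadraticMap.IsometryEquiv.apply_symm_apply, map_zero] at this
      simpa using congrFun this i
    rw [← e.map_app, e.apply_symm_apply, h1] at h2
    rcases hw i with h | h | h <;> linarith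
  refine ⟨e.toLinearEquiv.trans ((WithLp.linearEquiv 2 ℝ _).symm.trans
    (stdOrthonormalBasis ℝ V).repr.symm.toLinearEquiv), fun x => ?_⟩
  rw [← e.map_app, QuadraticMap.weightedSumSquares_apply]
  simp [hw1, ← sq, EuclideanSpace.real_norm_sq_eq]

theorem QuadraticForm.continuous_of_finiteDimensional {V : Type*} [NormedAddCommGroup V]
    [NormedSpace ℝ V] [FiniteDimensional ℝ V] (Q : QuadraticForm ℝ V) : Continuous Q := by
  have h : ∀ x, Q x =
      (QuadraticMap.associated (R := ℝ) Q).toContinuousBilinearMap x x := fun x =>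
    (QuadraticMap.associated_eq_self_apply ℝ Q x).symm
  rw [show (Q : V → ℝ) = _ from funext h]
  fun_prop

/-! ### Sandwiched quadratic forms and the optimal ratio -/

/-- The quadratic form `Q` lies between `p²` and `r p²`. -/
def Seminorm.Sandwiches {V : Type*} [AddCommGroup V] [Module ℝ V] (p : Seminorm ℝ V)
    (r : ℝ) (Q : QuadraticForm ℝ V) : Prop :=
  ∀ x, p x ^ 2 ≤ Q x ∧ Q x ≤ r * p x ^ 2

/-- The ratios `ρ` for which some quadratic form lies between `p²` and `(ρ p)²`. -/
def Seminorm.ratioSet {V : Type*} [AddCommGroup V] [Module ℝ V] (p : Seminorm ℝ V) : Set ℝ :=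
  {ρ : ℝ | 0 < ρ ∧ ∃ Q : QuadraticForm ℝ V, p.Sandwiches (ρ ^ 2) Q}

/-- The infimum of the ratios `ρ` for which some quadratic form lies between `p²` and `(ρ p)²`. -/
noncomputable def Seminorm.ratio {V : Type*} [AddCommGroup V] [Module ℝ V] (p : Seminorm ℝ V) :
    ℝ :=
  sInf p.ratioSet

section Algebraic

variable {V W : Type*} [AddCommGroup V] [Module ℝ V] [AddCommGroup W] [Module ℝ W]

theorem Seminorm.Sandwiches.comp {p : Seminorm ℝ V} {r : ℝ} {Q : QuadraticForm ℝ V}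
    (h : p.Sandwiches r Q) (f : W →ₗ[ℝ] V) : (p.comp f).Sandwiches r (Q.comp f) :=
  fun x => h (f x)

theorem Seminorm.ratioSet_subset_comp (p : Seminorm ℝ V) (f : W →ₗ[ℝ] V) :
    p.ratioSet ⊆ (p.comp f).ratioSet := by
  rintro ρ ⟨h0, Q, hQ⟩
  exact ⟨h0, _, hQ.comp f⟩

theorem Seminorm.ratio_comp_linearEquiv (p : Seminorm ℝ V) (e : W ≃ₗ[ℝ] V) :
    (p.comp (e : W →ₗ[ℝ] V)).ratio = p.ratio := by
  unfold Seminorm.ratio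
  congr 1
  refine (Set.Subset.antisymm (p.ratioSet_subset_comp _) ?_).symm
  have h := (p.comp (e : W →ₗ[ℝ] V)).ratioSet_subset_comp (e.symm : V →ₗ[ℝ] W)
  convert! h using 2
  ext x
  simp

theorem Seminorm.ratio_le (p : Seminorm ℝ V) {ρ : ℝ} (h : ρ ∈ p.ratioSet) : p.ratio ≤ ρ :=
  csInf_le ⟨0, fun _ hx => hx.1.le⟩ h

theorem Seminorm.Sandwiches.pos {p : Seminorm ℝ V} {r : ℝ} {Q : QuadraticForm ℝ V}
    (h : p.Sandwiches r Q) (hp : ∀ x, p x = 0 → x = 0) {x : V} (hx : x ≠ 0) : 0 < Q x :=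
  lt_of_lt_of_le (by have : p x ≠ 0 := fun h' => hx (hp x h')
                     positivity) (h x).1

theorem Seminorm.Sandwiches.one_le {p : Seminorm ℝ V} {r : ℝ} {Q : QuadraticForm ℝ V}
    (h : p.Sandwiches r Q) (hp : ∀ x, p x = 0 → x = 0) [Nontrivial V] : 1 ≤ r := by
  obtain ⟨x, hx⟩ := exists_ne (0 : V)
  have h1 : 0 < p x ^ 2 := by
    have : p x ≠ 0 := fun h' => hx (hp x h')
    positivity
  have h2 := (h x).1.trans (h x).2
  nlinarith

/-- Minimality of `p.ratio`, in terms of squared ratios. -/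
theorem Seminorm.Sandwiches.ratio_sq_le {p : Seminorm ℝ V} {r : ℝ} {Q : QuadraticForm ℝ V}
    (h : p.Sandwiches r Q) (hp : ∀ x, p x = 0 → x = 0) [Nontrivial V] : p.ratio ^ 2 ≤ r := by
  have h1 := h.one_le hp
  have h2 : p.ratio ≤ √r := p.ratio_le ⟨by positivity, Q, by rwa [Real.sq_sqrt (by linarith)]⟩
  have h3 : 0 ≤ p.ratio := Real.sInf_nonneg fun _ hx => hx.1.le
  calc p.ratio ^ 2 ≤ √r ^ 2 := by gcongr
    _ = r := Real.sq_sqrt (by linarith)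

/-- In a nontrivial space the ratio of a continuous norm is at least 1, so the value here excludes
the zero subspace from those preserving the ratio. -/
theorem Seminorm.ratio_of_subsingleton [Subsingleton V] (p : Seminorm ℝ V) : p.ratio = 0 := by
  have : p.ratioSet = Set.Ioi 0 := by
    ext ρ
    refine ⟨fun h => h.1, fun h => ⟨h, 0, fun x => ?_⟩⟩
    simp [Subsingleton.elim x 0]
  rw [Seminorm.ratio, this, csInf_Ioi]

end Algebraic

/-! ### Existence of an optimal form -/

section Attained

variable {V : Type*} [NormedAddCommGroup V] [InnerProductSpace ℝ V] [FiniteDimensional ℝ V]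

theorem Seminorm.exists_norm_le_mul (p : Seminorm ℝ V) (hc : Continuous p)
    (hp : ∀ x, p x = 0 → x = 0) : ∃ C, 0 < C ∧ ∀ x, ‖x‖ ≤ C * p x := by
  rcases subsingleton_or_nontrivial V with hV | hV
  · exact ⟨1, one_pos, fun x => by simp [Subsingleton.elim x 0]⟩
  have : ProperSpace V := FiniteDimensional.proper_real V
  obtain ⟨z, hz, hmin⟩ := (isCompact_sphere (0 : V) 1).exists_isMinOn
    (NormedSpace.sphere_nonempty.2 zero_le_one) hc.continuousOn
  have hz0 : z ≠ 0 := by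
    rintro rfl
    simp at hz
  have hpz : 0 < p z := lt_of_le_of_ne (apply_nonneg p z) fun h => hz0 (hp z h.symm)
  refine ⟨(p z)⁻¹, by positivity, fun x => ?_⟩
  rcases eq_or_ne x 0 with rfl | hx
  · simp
  have hx' : 0 < ‖x‖ := norm_pos_iff.2 hx
  have h1 : p z ≤ p (‖x‖⁻¹ • x) := hmin (by simp [norm_smul, hx'.ne'])
  rw [map_smul_eq_mul, norm_inv, norm_norm, ← div_eq_inv_mul, le_div_iff₀ hx'] at h1
  rwa [← div_eq_inv_mul, le_div_iff₀' hpz]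

theorem Seminorm.Sandwiches.exists_linearEquiv {p : Seminorm ℝ V} {r : ℝ} {Q : QuadraticForm ℝ V}
    (h : p.Sandwiches r Q) (hp : ∀ x, p x = 0 → x = 0) :
    ∃ T : V ≃ₗ[ℝ] V, ∀ x, Q x = ‖T x‖ ^ 2 :=
  exists_linearEquiv_norm_sq Q fun _ hx => h.pos hp hx

theorem Seminorm.ratioSet_nonempty (p : Seminorm ℝ V) (hc : Continuous p)
    (hp : ∀ x, p x = 0 → x = 0) : p.ratioSet.Nonempty := by
  obtain ⟨C, hC, h1⟩ := p.bound_of_continuous_normedSpace hc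
  obtain ⟨D, hD, h2⟩ := p.exists_norm_le_mul hc hp
  refine ⟨C * D, by positivity, (C ^ 2) • normSqForm V, fun x => ?_⟩
  have h3 := apply_nonneg p x
  simp only [_root_.smul_apply, normSqForm_apply, smul_eq_mul]
  refine ⟨?_, ?_⟩
  · rw [← mul_pow]
    gcongr
    exact h1 x
  · rw [mul_pow, mul_assoc, ← mul_pow D]
    gcongr
    exact h2 x

/-- The optimal ratio is attained by some quadratic form. -/
theorem Seminorm.exists_sandwiches_ratio [Nontrivial V] (p : Seminorm ℝ V) (hc : Continuous p)
    (hp : ∀ x, p x = 0 → x = 0) :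
    1 ≤ p.ratio ∧ ∃ Q, p.Sandwiches (p.ratio ^ 2) Q := by
  have hone : ∀ ρ ∈ p.ratioSet, 1 ≤ ρ := by
    rintro ρ ⟨h0, Q, hQ⟩
    nlinarith [hQ.one_le hp]
  obtain ⟨R, hR⟩ := p.ratioSet_nonempty hc hp
  obtain ⟨C, hC, h1⟩ := p.bound_of_continuous_normedSpace hc
  have hR0 : 0 < R := hR.1
  have : ProperSpace (V →L[ℝ] V) := FiniteDimensional.proper_real _
  -- Forms are parametrized by operators `T` through `Q = ‖T ·‖²`. The upper bound on `‖T x‖`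
  -- confines `T` to a ball of radius `R * C`, so the admissible pairs form a compact set on which
  -- `ρ` has a minimum.
  let F : Set (ℝ × (V →L[ℝ] V)) := (Set.Icc 0 R ×ˢ Metric.closedBall 0 (R * C)) ∩
    {z | ∀ x, p x ≤ ‖z.2 x‖ ∧ ‖z.2 x‖ ≤ z.1 * p x}
  have hF : IsCompact F := by
    refine (isCompact_Icc.prod (isCompact_closedBall _ _)).inter_right ?_
    simp only [Set.ofPred_forall]
    refine isClosed_iInter fun x => IsClosed.and ?_ ?_
    · exact isClosed_le (by fun_prop) (by fun_prop)
    · exact isClosed_le (by fun_prop) (by fun_prop)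
  have hmem : ∀ ρ ∈ p.ratioSet, ρ ≤ R → ∃ T, (ρ, T) ∈ F := by
    rintro ρ ⟨h0, Q, hQ⟩ hρ
    obtain ⟨T, hT⟩ := hQ.exists_linearEquiv hp
    have hT' : ∀ x, p x ≤ ‖T x‖ ∧ ‖T x‖ ≤ ρ * p x := by
      intro x
      have h2 := hQ x
      have h3 := apply_nonneg p x
      rw [hT, ← mul_pow] at h2
      exact ⟨(sq_le_sq₀ h3 (norm_nonneg _)).1 h2.1,
        (sq_le_sq₀ (norm_nonneg _) (by positivity)).1 h2.2⟩
    refine ⟨LinearMap.toContinuousLinearMap (T : V →ₗ[ℝ] V), ⟨⟨⟨h0.le, hρ⟩, ?_⟩, hT'⟩⟩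
    rw [mem_closedBall_zero_iff]
    refine ContinuousLinearMap.opNorm_le_bound _ (by positivity) fun x => ?_
    calc ‖T x‖ ≤ ρ * p x := (hT' x).2
      _ ≤ R * (C * ‖x‖) := by
        have := apply_nonneg p x
        gcongr
        exact h1 x
      _ = R * C * ‖x‖ := by ring
  obtain ⟨T₀, hT₀⟩ := hmem R hR le_rfl
  obtain ⟨⟨ρ, T⟩, hρT, hmin⟩ := hF.exists_isMinOn ⟨_, hT₀⟩ continuous_fst.continuousOn
  obtain ⟨⟨⟨hρ0, hρR⟩, -⟩, hT⟩ := hρT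
  simp only at hρ0 hρR hT
  have hsand : p.Sandwiches (ρ ^ 2) ((normSqForm V).comp (T : V →ₗ[ℝ] V)) := by
    intro x
    have := apply_nonneg p x
    simp only [QuadraticMap.comp_apply, normSqForm_apply, ContinuousLinearMap.coe_coe]
    rw [← mul_pow]
    exact ⟨by gcongr; exact (hT x).1, by gcongr; exact (hT x).2⟩
  have hρ1 : 1 ≤ ρ := by nlinarith [hsand.one_le hp]
  have hle : p.ratio = ρ := by
    refine le_antisymm (p.ratio_le ⟨by linarith, _, hsand⟩) (le_csInf ⟨R, hR⟩ fun σ hσ => ?_)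
    rcases le_total σ R with h | h
    · obtain ⟨S, hS⟩ := hmem σ hσ h
      exact hmin hS
    · exact hρR.trans h
  exact ⟨hle ▸ hρ1, _, hle ▸ hsand⟩

end Attained

/-! ### Contact points and descent to a proper subspace -/

/-- Only points with `g ≤ 0` can cause trouble. They form a compact set on which `f` is positive,
hence bounded away from 0, while `g` is bounded below. -/
theorem IsCompact.exists_forall_convexComb_nonneg {X : Type*} [TopologicalSpace X] {S : Set X}
    (hS : IsCompact S) {f g : X → ℝ} (hf : Continuous f) (hg : Continuous g)
    (hf0 : ∀ x ∈ S, 0 ≤ f x) (hfg : ∀ x ∈ S, f x = 0 → 0 < g x) :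
    ∃ δ, 0 < δ ∧ δ ≤ 1 ∧ ∀ ε, 0 < ε → ε ≤ δ → ∀ x ∈ S, 0 ≤ (1 - ε) * f x + ε * g x := by
  have hS' : IsCompact (S ∩ {x | g x ≤ 0}) :=
    hS.inter_right (isClosed_le hg continuous_const)
  rcases (S ∩ {x | g x ≤ 0}).eq_empty_or_nonempty with he | hne
  · refine ⟨1, one_pos, le_rfl, fun ε h0 h1 x hx => ?_⟩
    have hgx : 0 < g x := by
      by_contra! h
      exact he.le ⟨hx, h⟩
    have := mul_nonneg (sub_nonneg.2 h1) (hf0 x hx)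
    positivity
  · obtain ⟨z, ⟨hzS, hz⟩, hzmin⟩ := hS'.exists_isMinOn hne hf.continuousOn
    obtain ⟨y, ⟨hyS, hy⟩, hymin⟩ := hS'.exists_isMinOn hne hg.continuousOn
    simp only [Set.mem_ofPred_eq] at hz hy
    have hfz : 0 < f z := lt_of_le_of_ne (hf0 z hzS) fun h => (hfg z hzS h.symm).not_ge hz
    refine ⟨f z / (f z - g y), div_pos hfz (by linarith), (div_le_one (by linarith)).2 (by linarith),
      fun ε h0 h1 x hx => ?_⟩
    rw [le_div_iff₀ (by linarith)] at h1
    have hε : ε ≤ 1 := by nlinarith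
    rcases le_or_gt (g x) 0 with hgx | hgx
    · have h2 : f z ≤ f x := hzmin ⟨hx, hgx⟩
      have h3 : g y ≤ g x := hymin ⟨hx, hgx⟩
      nlinarith
    · have := mul_nonneg (sub_nonneg.2 hε) (hf0 x hx)
      positivity

section

variable {V : Type*} [NormedAddCommGroup V] [InnerProductSpace ℝ V] [FiniteDimensional ℝ V]

/-- A form with optimal ratio cannot be improved to first order at all its contact points. -/
theorem Seminorm.Sandwiches.not_forall_contact [Nontrivial V] {p : Seminorm ℝ V}
    (hc : Continuous p) (hp : ∀ x, p x = 0 → x = 0) {M R : QuadraticForm ℝ V}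
    (hM : p.Sandwiches (p.ratio ^ 2) M) {σ : ℝ} (hσ : σ < p.ratio ^ 2)
    (hlow : ∀ x, x ≠ 0 → M x = p x ^ 2 → p x ^ 2 < R x)
    (hup : ∀ x, x ≠ 0 → M x = p.ratio ^ 2 * p x ^ 2 → R x < σ * p x ^ 2) : False := by
  have : ProperSpace V := FiniteDimensional.proper_real V
  have hMc := M.continuous_of_finiteDimensional
  have hRc := R.continuous_of_finiteDimensional
  have hne : ∀ x ∈ Metric.sphere (0 : V) 1, x ≠ 0 := by
    rintro x hx rfl
    simp at hx
  obtain ⟨δ₁, h1pos, h1le, h1⟩ := (isCompact_sphere (0 : V) 1).exists_forall_convexComb_nonneg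
    (f := fun x => M x - p x ^ 2) (g := fun x => R x - p x ^ 2) (by fun_prop) (by fun_prop)
    (fun x _ => sub_nonneg.2 (hM x).1)
    (fun x hx h => sub_pos.2 (hlow x (hne x hx) (sub_eq_zero.1 h)))
  obtain ⟨δ₂, h2pos, h2le, h2⟩ := (isCompact_sphere (0 : V) 1).exists_forall_convexComb_nonneg
    (f := fun x => p.ratio ^ 2 * p x ^ 2 - M x) (g := fun x => σ * p x ^ 2 - R x)
    (by fun_prop) (by fun_prop) (fun x _ => sub_nonneg.2 (hM x).2)
    (fun x hx h => sub_pos.2 (hup x (hne x hx) (sub_eq_zero.1 h).symm))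
  have hε0 : 0 < min δ₁ δ₂ := lt_min h1pos h2pos
  set ε := min δ₁ δ₂ with hε
  have hsand : p.Sandwiches ((1 - ε) * p.ratio ^ 2 + ε * σ) ((1 - ε) • M + ε • R) := by
    intro x
    rcases eq_or_ne x 0 with rfl | hx
    · simp
    have hx' : 0 < ‖x‖ := norm_pos_iff.2 hx
    obtain ⟨y, hy, hxy⟩ : ∃ y ∈ Metric.sphere (0 : V) 1, x = ‖x‖ • y :=
      ⟨‖x‖⁻¹ • x, by simp [norm_smul, hx'.ne'], by simp [smul_smul, hx'.ne']⟩
    have e1 := h1 ε hε0 (min_le_left _ _) y hy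
    have e2 := h2 ε hε0 (min_le_right _ _) y hy
    rw [hxy]
    generalize ‖x‖ = t at *
    simp only [map_smul_eq_mul, QuadraticMap.map_smul, _root_.add_apply, _root_.smul_apply,
      smul_eq_mul, Real.norm_eq_abs, mul_pow, sq_abs]
    have ht : 0 ≤ t * t := mul_self_nonneg t
    have e3 := mul_nonneg ht e1
    have e4 := mul_nonneg ht e2
    constructor <;> nlinarith
  have := hsand.ratio_sq_le hp
  nlinarith

/-- From two forms with the same ratio one obtains a third one, all of whose contact points lie in
a subspace on which the first two forms agree. -/
theorem Seminorm.Sandwiches.exists_mean {p : Seminorm ℝ V} {r : ℝ}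
    (hp : ∀ x, p x = 0 → x = 0) {Q₁ Q₂ : QuadraticForm ℝ V}
    (h₁ : p.Sandwiches r Q₁) (h₂ : p.Sandwiches r Q₂) :
    ∃ (M : QuadraticForm ℝ V) (U : Submodule ℝ V), p.Sandwiches r M ∧
      (∀ x, M x = p x ^ 2 → x ∈ U) ∧ (∀ x, M x = r * p x ^ 2 → x ∈ U) ∧
      ∀ x ∈ U, Q₁ x = Q₂ x := by
  obtain ⟨T, hT⟩ := h₁.exists_linearEquiv hp
  obtain ⟨S, hS⟩ := h₂.exists_linearEquiv hp
  let D : V →ₗ[ℝ] V := LinearMap.adjoint (T : V →ₗ[ℝ] V) ∘ₗ (T : V →ₗ[ℝ] V) -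
    LinearMap.adjoint (S : V →ₗ[ℝ] V) ∘ₗ (S : V →ₗ[ℝ] V)
  have hD : ∀ x y, inner ℝ (D x) y = inner ℝ (T x) (T y) - inner ℝ (S x) (S y) := by
    intro x y
    simp [D, inner_sub_left, LinearMap.adjoint_inner_left]
  let T' := LinearMap.toContinuousLinearMap (T : V →ₗ[ℝ] V)
  let S' := LinearMap.toContinuousLinearMap (S : V →ₗ[ℝ] V)
  let G := ‖T'‖ ^ 2 + ‖S'‖ ^ 2 + 1
  have hG : 0 < G := by positivity
  have hTS : ∀ x, ‖T x‖ ^ 2 + ‖S x‖ ^ 2 ≤ G * ‖x‖ ^ 2 := by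
    intro x
    have e1 : ‖T x‖ ^ 2 ≤ (‖T'‖ * ‖x‖) ^ 2 := by gcongr; exact T'.le_opNorm x
    have e2 : ‖S x‖ ^ 2 ≤ (‖S'‖ * ‖x‖) ^ 2 := by gcongr; exact S'.le_opNorm x
    simp only [G]
    nlinarith [sq_nonneg ‖x‖]
  -- With this size the second-order term `2 ε² G ‖D x‖²` in `H` consumes only half of the
  -- first-order gain `2 ε ‖D x‖²`.
  let ε := 1 / (2 * G)
  have hε : 0 < ε := by positivity
  have hεG : ε * G = 1 / 2 := by simp only [ε]; field_simp
  let C : QuadraticForm ℝ V := (1 / 2 : ℝ) • (Q₁ + Q₂)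
  -- Any splitting `x = y + z` gives `p x ^ 2 ≤ 2 * (Q₁ y + Q₂ z)`. The equal splitting yields `C`;
  -- moving it along `D`, a descent direction, lowers the value by at least `ε ‖D x‖²` while it
  -- stays above `p²`.
  let H : QuadraticForm ℝ V := (2 : ℝ) • (Q₁.comp ((1 / 2 : ℝ) • LinearMap.id - ε • D) +
    Q₂.comp ((1 / 2 : ℝ) • LinearMap.id + ε • D))
  have hC : ∀ x, C x = 1 / 2 * (Q₁ x + Q₂ x) := fun x => by simp [C, mul_add]
  have hH : ∀ x, H x = 2 * (Q₁ ((1 / 2 : ℝ) • x - ε • D x) + Q₂ ((1 / 2 : ℝ) • x + ε • D x)) :=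
    fun x => by simp [H, mul_add]
  have hHC : ∀ x, H x ≤ C x - ε * ‖D x‖ ^ 2 := by
    intro x
    have e1 := hTS (D x)
    have e2 : ‖D x‖ ^ 2 = inner ℝ (T x) (T (D x)) - inner ℝ (S x) (S (D x)) := by
      rw [← hD, real_inner_self_eq_norm_sq]
    have e3 := mul_le_mul_of_nonneg_left e1 (sq_nonneg ε)
    have e4 : ε ^ 2 * (G * ‖D x‖ ^ 2) = ε / 2 * ‖D x‖ ^ 2 := by
      linear_combination ε * ‖D x‖ ^ 2 * hεG
    rw [hH, hC, hT, hS, hT, hS, map_sub, map_add, map_smul, map_smul, map_smul, map_smul,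
      norm_sub_sq_real, norm_add_sq_real]
    simp only [norm_smul, real_inner_smul_left, real_inner_smul_right, mul_pow, Real.norm_eq_abs,
      sq_abs]
    rw [e4] at e3
    nlinarith
  have hpH : ∀ x, p x ^ 2 ≤ H x := by
    intro x
    rw [hH]
    set y := (1 / 2 : ℝ) • x - ε • D x with hy
    set z := (1 / 2 : ℝ) • x + ε • D x with hz
    have hx : x = y + z := by
      rw [hy, hz]
      module
    have e1 : p x ≤ p y + p z := by
      rw [hx]
      exact map_add_le_add p y z
    have e2 := apply_nonneg p x
    nlinarith [(h₁ y).1, (h₂ z).1, sq_nonneg (p y - p z)]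
  have hpC : ∀ x, p x ^ 2 ≤ C x := fun x => by rw [hC]; linarith [(h₁ x).1, (h₂ x).1]
  have hCp : ∀ x, C x ≤ r * p x ^ 2 := fun x => by rw [hC]; linarith [(h₁ x).2, (h₂ x).2]
  have hM : ∀ x, ((1 / 2 : ℝ) • (C + H)) x = 1 / 2 * (C x + H x) := fun x => by simp [mul_add]
  have hker : ∀ x, ε * ‖D x‖ ^ 2 ≤ 0 → x ∈ LinearMap.ker D := by
    intro x hx
    have h0 : ‖D x‖ ^ 2 ≤ 0 := by
      by_contra! h
      have := mul_pos hε h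
      linarith
    simpa using le_antisymm h0 (sq_nonneg _)
  -- Off `ker D` one has `p² ≤ H < C ≤ r p²`, so the midpoint of `C` and `H` touches neither bound.
  refine ⟨(1 / 2 : ℝ) • (C + H), LinearMap.ker D, fun x => ?_, fun x hx => hker x ?_,
    fun x hx => hker x ?_, fun x hx => ?_⟩
  · rw [hM]
    have e1 : 0 ≤ ε * ‖D x‖ ^ 2 := by positivity
    constructor <;> linarith [hpH x, hpC x, hCp x, hHC x]
  · rw [hM] at hx
    linarith [hpH x, hpC x, hCp x, hHC x]
  · rw [hM] at hx
    linarith [hpH x, hpC x, hCp x, hHC x]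
  · have e1 := hD x x
    rw [LinearMap.mem_ker.1 hx, inner_zero_left, real_inner_self_eq_norm_sq,
      real_inner_self_eq_norm_sq] at e1
    rw [hT, hS]
    linarith

/-- The contact points of the mean form lie in `U`, so a better form on `U` matters only there and
may be extended by the orthogonal projection. -/
theorem Seminorm.Sandwiches.exists_submodule_ratio_eq [Nontrivial V] {p : Seminorm ℝ V}
    (hc : Continuous p) (hp : ∀ x, p x = 0 → x = 0) {Q₁ Q₂ : QuadraticForm ℝ V}
    (h₁ : p.Sandwiches (p.ratio ^ 2) Q₁) (h₂ : p.Sandwiches (p.ratio ^ 2) Q₂) (hne : Q₁ ≠ Q₂) :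
    ∃ U : Submodule ℝ V, U ≠ ⊤ ∧ (p.comp U.subtype).ratio = p.ratio := by
  obtain ⟨M, U, hM, hlow, hup, hU⟩ := h₁.exists_mean hp h₂
  refine ⟨U, ?_, ?_⟩
  · rintro rfl
    exact hne (QuadraticMap.ext fun x => hU x trivial)
  have hcU : Continuous (p.comp U.subtype) := hc.comp continuous_subtype_val
  have hpU : ∀ x, p.comp U.subtype x = 0 → x = 0 := fun x hx => Subtype.ext (hp x hx)
  have hset := p.ratioSet_nonempty hc hp
  have h1 := (p.exists_sandwiches_ratio hc hp).1
  refine le_antisymm (csInf_le_csInf ⟨0, fun _ hx => hx.1.le⟩ hset (p.ratioSet_subset_comp _)) ?_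
  by_contra! hlt
  obtain ⟨ρ, ⟨hρ0, Q, hQ⟩, hρ⟩ := exists_lt_of_csInf_lt
    ((p.comp U.subtype).ratioSet_nonempty hcU hpU) hlt
  have hsq : ρ ^ 2 < p.ratio ^ 2 := by gcongr
  obtain ⟨σ, hσ1, hσ2⟩ := exists_between hsq
  -- Scaling by `s > 1` makes the lower inequality strict, while `s * ρ ^ 2 < σ` keeps the upper one
  -- strict.
  obtain ⟨s, hs1, hs2⟩ := exists_between ((one_lt_div (by positivity)).2 hσ1)
  rw [lt_div_iff₀ (by positivity)] at hs2
  have hproj : ∀ x (hx : x ∈ U), (s • Q.comp (U.orthogonalProjectionOnto : V →ₗ[ℝ] U)) x =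
      s * Q ⟨x, hx⟩ := by
    intro x hx
    have : U.orthogonalProjectionOnto x = ⟨x, hx⟩ :=
      Submodule.orthogonalProjectionOnto_mem_subspace_eq_self (⟨x, hx⟩ : U)
    simp [this]
  have hpos : ∀ x, x ≠ 0 → 0 < p x ^ 2 := by
    intro x hx
    have : p x ≠ 0 := fun h => hx (hp x h)
    positivity
  refine hM.not_forall_contact (R := s • Q.comp (U.orthogonalProjectionOnto : V →ₗ[ℝ] U)) hc hp hσ2
    (fun x hx h => ?_) (fun x hx h => ?_)
  · rw [hproj x (hlow x h)]
    have e1 : p x ^ 2 ≤ Q ⟨x, hlow x h⟩ := (hQ ⟨x, hlow x h⟩).1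
    have e2 := hpos x hx
    nlinarith
  · rw [hproj x (hup x h)]
    have e1 : Q ⟨x, hup x h⟩ ≤ ρ ^ 2 * p x ^ 2 := (hQ ⟨x, hup x h⟩).2
    have e2 := hpos x hx
    nlinarith

end

/-! ### Symmetric bodies and ellipsoids with arbitrary centers -/

theorem Seminorm.sq_le_mul_sq_of_unit {V : Type*} [AddCommGroup V] [Module ℝ V]
    {p q : Seminorm ℝ V} (hp : ∀ x, p x = 0 → x = 0) {r : ℝ}
    (h : ∀ x, p x ≤ 1 → q x ^ 2 ≤ r) (x : V) : q x ^ 2 ≤ r * p x ^ 2 := by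
  rcases eq_or_ne x 0 with rfl | hx
  · simp
  have hpx : 0 < p x := lt_of_le_of_ne (apply_nonneg p x) fun h' => hx (hp x h'.symm)
  have h1 := h ((p x)⁻¹ • x) (by simp [map_smul_eq_mul, abs_of_pos hpx, hpx.ne'])
  rw [map_smul_eq_mul, norm_inv, Real.norm_of_nonneg hpx.le, mul_pow, inv_pow,
    inv_mul_le_iff₀ (by positivity)] at h1
  linarith

section

variable {V : Type*} [NormedAddCommGroup V] [InnerProductSpace ℝ V]

theorem Seminorm.sq_le_norm_symm_sq {p : Seminorm ℝ V} {r : ℝ} (T : V ≃ₗ[ℝ] V)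
    (h : ∀ b, ‖b‖ ≤ 1 → p (T b) ^ 2 ≤ r) (x : V) : p x ^ 2 ≤ r * ‖T.symm x‖ ^ 2 := by
  have := Seminorm.sq_le_mul_sq_of_unit (p := normSeminorm ℝ V)
    (q := p.comp (T : V →ₗ[ℝ] V)) (fun x hx => norm_eq_zero.1 hx) h (T.symm x)
  simpa using this

theorem Seminorm.norm_symm_sq_le {p : Seminorm ℝ V} (hp : ∀ x, p x = 0 → x = 0) {r : ℝ}
    (T : V ≃ₗ[ℝ] V) (h : ∀ x, p x ≤ 1 → ‖T.symm x‖ ^ 2 ≤ r) (x : V) :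
    ‖T.symm x‖ ^ 2 ≤ r * p x ^ 2 :=
  Seminorm.sq_le_mul_sq_of_unit (q := (normSeminorm ℝ V).comp (T.symm : V →ₗ[ℝ] V)) hp h x

/-- If all centered distance ellipsoids agree, then no further translate of a distance ellipsoid
is inscribed in the unit ball of `p`: otherwise it could be stretched in the direction of the
translation. -/
theorem Seminorm.eq_zero_of_translate_mem {p : Seminorm ℝ V} {r : ℝ}
    (huniq : ∀ Q₁ Q₂, p.Sandwiches r Q₁ → p.Sandwiches r Q₂ → Q₁ = Q₂) (T : V ≃ₗ[ℝ] V)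
    (hT : p.Sandwiches r ((normSqForm V).comp (T.symm : V →ₗ[ℝ] V))) {c : V}
    (hc : ∀ b, ‖b‖ ≤ 1 → p (c + T b) ≤ 1) : c = 0 := by
  by_contra hc0
  set a := T.symm c with ha
  have ha0 : a ≠ 0 := by simpa [ha] using hc0
  have haT : T a = c := by simp [ha]
  set g := ‖a‖ ^ 2 with hg
  have hg0 : 0 < g := by positivity
  -- Small enough that `|s| ≤ ‖f x‖` below, where `s` is the coefficient of `c` in `x = T (f x) + s
  -- • c`.
  set k : ℝ := 1 / (3 * (1 + g)) with hk
  have hk0 : 0 < k := by positivity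
  have hk1 : 3 * k + 3 * (k * g) = 1 := by
    rw [hk]
    field_simp
  have hkg : 0 < k * g := by positivity
  let f : V →ₗ[ℝ] V := (LinearMap.id - k • (innerₗ V a).smulRight a) ∘ₗ (T.symm : V →ₗ[ℝ] V)
  have hf : ∀ x, f x = T.symm x - (k * inner ℝ a (T.symm x)) • a := by
    intro x
    simp [f, mul_smul]
  have hfn : ∀ x, ‖f x‖ ^ 2 =
      ‖T.symm x‖ ^ 2 - (2 * k - k * (k * g)) * inner ℝ a (T.symm x) ^ 2 := by
    intro x
    rw [hf, norm_sub_sq_real, norm_smul, real_inner_smul_right, mul_pow, ← hg, Real.norm_eq_abs,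
      sq_abs, real_inner_comm a (T.symm x)]
    ring
  have hCS : ∀ y, inner ℝ a y ^ 2 ≤ g * ‖y‖ ^ 2 := by
    intro y
    rw [hg, ← mul_pow, ← sq_abs]
    gcongr
    exact abs_real_inner_le_norm a y
  have hc' : ∀ b, b ≠ 0 → p (T b + ‖b‖ • c) ≤ ‖b‖ := by
    intro b hb
    have hb' : 0 < ‖b‖ := norm_pos_iff.2 hb
    have e1 := hc (‖b‖⁻¹ • b) (by simp [norm_smul, hb'.ne'])
    have e2 : T b + ‖b‖ • c = ‖b‖ • (c + T (‖b‖⁻¹ • b)) := by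
      rw [map_smul, smul_add, smul_smul, mul_inv_cancel₀ hb'.ne', one_smul, add_comm]
    rw [e2, map_smul_eq_mul, norm_norm]
    nlinarith
  have hQ : p.Sandwiches r ((normSqForm V).comp f) := by
    intro x
    have hx := (hT x).2
    simp only [QuadraticMap.comp_apply, normSqForm_apply, LinearEquiv.coe_coe] at hx ⊢
    constructor
    -- The point `x` lies on the segment joining `T (f x) ± ‖f x‖ • c`. By symmetry of `p`, both
    -- endpoints have `p`-value at most `‖f x‖`.
    · set s := k * inner ℝ a (T.symm x) with hs
      have hxs : x = T (f x) + s • c := by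
        rw [hf, map_sub, map_smul, haT, LinearEquiv.apply_symm_apply]
        abel
      have hsb : s ^ 2 ≤ ‖f x‖ ^ 2 := by
        have e1 := hCS (T.symm x)
        have e2 : s ^ 2 = k ^ 2 * inner ℝ a (T.symm x) ^ 2 := by rw [hs]; ring
        have e3 : (k ^ 2 + (2 * k - k * (k * g))) * inner ℝ a (T.symm x) ^ 2 ≤
            (k ^ 2 + (2 * k - k * (k * g))) * (g * ‖T.symm x‖ ^ 2) := by
          refine mul_le_mul_of_nonneg_left e1 ?_
          nlinarith
        have e4 : (k ^ 2 + (2 * k - k * (k * g))) * g ≤ 1 := by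
          nlinarith [mul_pos hk0 hkg]
        have e5 := mul_le_mul_of_nonneg_right e4 (sq_nonneg ‖T.symm x‖)
        rw [hfn, e2]
        linarith
      rcases eq_or_ne (f x) 0 with h0 | h0
      · rw [h0, norm_zero] at hsb
        have hs0 : s = 0 := by nlinarith
        rw [hxs, h0, hs0]
        simp
      · have hb : 0 < ‖f x‖ := norm_pos_iff.2 h0
        obtain ⟨hs1, hs2⟩ := abs_le.1 ((sq_le_sq₀ (abs_nonneg s) hb.le).1 (by rwa [sq_abs]))
        have e1 := hc' (f x) h0
        have e2 : p (T (f x) - ‖f x‖ • c) ≤ ‖f x‖ := by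
          have := hc' (-f x) (neg_ne_zero.2 h0)
          rw [norm_neg, map_neg, ← map_neg_eq_map] at this
          convert! this using 2
          abel
        have e3 : (2 * ‖f x‖) • x = (‖f x‖ + s) • (T (f x) + ‖f x‖ • c) +
            (‖f x‖ - s) • (T (f x) - ‖f x‖ • c) := by
          calc (2 * ‖f x‖) • x = (2 * ‖f x‖) • (T (f x) + s • c) := congrArg _ hxs
            _ = _ := by module
        have e4 := map_add_le_add p ((‖f x‖ + s) • (T (f x) + ‖f x‖ • c))
          ((‖f x‖ - s) • (T (f x) - ‖f x‖ • c))
        rw [← e3, map_smul_eq_mul, map_smul_eq_mul, map_smul_eq_mul,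
          Real.norm_of_nonneg (by positivity), Real.norm_of_nonneg (by linarith),
          Real.norm_of_nonneg (by linarith)] at e4
        have e5 := mul_le_mul_of_nonneg_left e1 (by linarith : 0 ≤ ‖f x‖ + s)
        have e6 := mul_le_mul_of_nonneg_left e2 (by linarith : 0 ≤ ‖f x‖ - s)
        have e7 : p x ≤ ‖f x‖ := by nlinarith
        have := apply_nonneg p x
        gcongr
    · refine le_trans ?_ hx
      rw [hfn]
      have : 0 ≤ (2 * k - k * (k * g)) * inner ℝ a (T.symm x) ^ 2 := by
        refine mul_nonneg ?_ (sq_nonneg _)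
        nlinarith
      linarith
  have h := congrArg (fun Q => Q c) (huniq _ _ hQ hT)
  simp only [QuadraticMap.comp_apply, normSqForm_apply, LinearEquiv.coe_coe, hfn, ← ha,
    real_inner_self_eq_norm_sq, ← hg] at h
  have : 0 < (2 * k - k * (k * g)) * g ^ 2 := by
    refine mul_pos ?_ (by positivity)
    nlinarith
  linarith

/-- A symmetric convex body is the unit ball of a norm. -/
theorem ConvexBody.exists_seminorm (K : ConvexBody V) (hint : (interior (K : Set V)).Nonempty)
    (hsymm : -(K : Set V) = (K : Set V)) :
    ∃ p : Seminorm ℝ V, Continuous p ∧ (∀ x, p x = 0 → x = 0) ∧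
      ∀ x, x ∈ (K : Set V) ↔ p x ≤ 1 := by
  have hneg : ∀ x ∈ (K : Set V), -x ∈ (K : Set V) := fun x hx => by
    rw [← hsymm]
    simpa using hx
  have h0 : (K : Set V) ∈ nhds 0 := by
    obtain ⟨x, hx⟩ := hint
    have := K.convex.openSegment_interior_self_subset_interior hx (hneg x (interior_subset hx))
    rw [← mem_interior_iff_mem_nhds]
    exact this ⟨1 / 2, 1 / 2, by norm_num, by norm_num, by norm_num, by simp⟩
  have habs : Absorbent ℝ (K : Set V) := absorbent_nhds_zero h0
  have hbal : Balanced ℝ (K : Set V) := by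
    rw [balanced_iff_neg_mem K.convex]
    exact fun {x} hx => hneg x hx
  refine ⟨gaugeSeminorm hbal K.convex habs, continuous_gauge K.convex h0, fun x hx => ?_,
    fun x => ?_⟩
  · exact (gauge_eq_zero habs ((NormedSpace.isVonNBounded_iff ℝ).2 K.isCompact.isBounded)).1 hx
  · have := gauge_le_one_iff_mem_closure (x := x) K.convex h0
    rw [K.isCompact.isClosed.closure_eq] at this
    exact this.symm

end

section

variable {V : Type*} [NormedAddCommGroup V] [InnerProductSpace ℝ V] [FiniteDimensional ℝ V]

theorem Seminorm.Sandwiches.exists_linearEquiv_le {p : Seminorm ℝ V} {ρ : ℝ}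
    {Q : QuadraticForm ℝ V} (h : p.Sandwiches (ρ ^ 2) Q) (hρ : 0 ≤ ρ)
    (hp : ∀ x, p x = 0 → x = 0) :
    ∃ T : V ≃ₗ[ℝ] V, (∀ x, Q x = ‖T x‖ ^ 2) ∧ ∀ x, p x ≤ ‖T x‖ ∧ ‖T x‖ ≤ ρ * p x := by
  obtain ⟨T, hT⟩ := h.exists_linearEquiv hp
  refine ⟨T, hT, fun x => ?_⟩
  have h2 := h x
  have h3 := apply_nonneg p x
  rw [hT, ← mul_pow] at h2
  exact ⟨(sq_le_sq₀ h3 (norm_nonneg _)).1 h2.1,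
    (sq_le_sq₀ (norm_nonneg _) (by positivity)).1 h2.2⟩

/-- For a body which is the unit ball of a norm, the Banach-Mazur distance to the Euclidean ball
can be computed with centered ellipsoids only. -/
theorem Seminorm.banachMazurDist_eq_ratio {p : Seminorm ℝ V} (hp : ∀ x, p x = 0 → x = 0)
    {K : Set V} (hK : ∀ x, x ∈ K ↔ p x ≤ 1) : banachMazurDist K (unitBall V) = p.ratio := by
  unfold banachMazurDist Seminorm.ratio
  congr 1
  ext ρ
  constructor
  · rintro ⟨hρ, T, u, v, h1, h2⟩
    refine ⟨hρ, (ρ ^ 2) • (normSqForm V).comp (T.symm : V →ₗ[ℝ] V), fun x => ?_⟩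
    simp only [_root_.smul_apply, QuadraticMap.comp_apply, normSqForm_apply, smul_eq_mul,
      LinearEquiv.coe_coe]
    have h1' : ∀ x, p x ≤ 1 → ‖T.symm (u + x) - v‖ ≤ 1 := by
      intro x hx
      obtain ⟨_, ⟨b, hb, rfl⟩, hb'⟩ := h1 ⟨x, (hK x).2 hx, rfl⟩
      simp only [vadd_eq_add] at hb'
      rw [← hb']
      simpa [unitBall] using hb
    have h2' : ∀ b, ‖b‖ ≤ 1 → ∃ k, p k ≤ 1 ∧ T (v + b) = ρ • (u + k) := by
      intro b hb
      obtain ⟨_, ⟨k, hk, rfl⟩, hk'⟩ := h2 ⟨v + b, ⟨b, by simpa [unitBall] using hb, rfl⟩, rfl⟩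
      exact ⟨k, (hK k).1 hk, by simpa using hk'.symm⟩
    constructor
    -- Subtracting the inclusions for `b` and `-b` cancels `u` and `v`; the other bound uses `x` and
    -- `-x` likewise.
    · refine Seminorm.sq_le_norm_symm_sq T (fun b hb => ?_) x
      obtain ⟨k, hk, hk'⟩ := h2' b hb
      obtain ⟨l, hl, hl'⟩ := h2' (-b) (by rwa [norm_neg])
      have e1 : T b = (ρ / 2) • (k - l) := by
        have : (2 : ℝ) • T b = ρ • (k - l) := by
          calc (2 : ℝ) • T b = T (v + b) - T (v + -b) := by
                simp only [map_add, map_neg]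
                module
            _ = ρ • (k - l) := by
                rw [hk', hl']
                module
        rw [div_eq_inv_mul, mul_smul, ← this, smul_smul]
        norm_num
      have e2 : p (T b) ≤ ρ := by
        rw [e1, map_smul_eq_mul, Real.norm_of_nonneg (by positivity)]
        have := map_sub_le_add p k l
        nlinarith
      gcongr
    · refine mul_le_mul_of_nonneg_left ?_ (sq_nonneg ρ)
      have := Seminorm.norm_symm_sq_le hp T (r := 1) (fun x hx => ?_) x
      · simpa using this
      have e1 := h1' x hx
      have e2 := h1' (-x) (by rwa [map_neg_eq_map])
      have e3 : (2 : ℝ) • T.symm x = (T.symm (u + x) - v) - (T.symm (u + -x) - v) := by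
        simp only [map_add, map_neg]
        module
      have e4 : ‖(2 : ℝ) • T.symm x‖ ≤ 2 := by
        rw [e3]
        exact (norm_sub_le _ _).trans (by linarith)
      rw [norm_smul, Real.norm_of_nonneg zero_le_two] at e4
      nlinarith [norm_nonneg (T.symm x)]
  · rintro ⟨hρ, Q, hQ⟩
    obtain ⟨S, -, hS⟩ := hQ.exists_linearEquiv_le hρ.le hp
    refine ⟨hρ, S.symm.trans (LinearEquiv.smulOfNeZero ℝ V ρ hρ.ne'), 0, 0, ?_, ?_⟩
    · rw [zero_vadd, zero_vadd]
      intro x hx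
      refine ⟨ρ⁻¹ • S x, ?_, by simp [smul_smul, hρ.ne']⟩
      have e1 := (hS x).2
      have e2 := (hK x).1 hx
      rw [unitBall, mem_closedBall_zero_iff, norm_smul, norm_inv, Real.norm_of_nonneg hρ.le,
        inv_mul_le_iff₀ hρ]
      nlinarith
    · rw [zero_vadd, zero_vadd]
      rintro _ ⟨b, hb, rfl⟩
      rw [unitBall, mem_closedBall_zero_iff] at hb
      refine ⟨S.symm b, (hK _).2 ?_, by simp⟩
      have := (hS (S.symm b)).1
      rw [LinearEquiv.apply_symm_apply] at this
      linarith

/-- An off-center outer ellipsoid would leave room for a ratio below the optimum, and an off-center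
inner one would produce a second optimal form. -/
theorem Seminorm.existsUnique_isDistanceEllipsoidPair [Nontrivial V] {p : Seminorm ℝ V}
    (hcont : Continuous p) (hp : ∀ x, p x = 0 → x = 0)
    (huniq : ∀ Q₁ Q₂, p.Sandwiches (p.ratio ^ 2) Q₁ → p.Sandwiches (p.ratio ^ 2) Q₂ → Q₁ = Q₂)
    {K : Set V} (hK : ∀ x, x ∈ K ↔ p x ≤ 1) :
    ∃! E : Set V × Set V, IsDistanceEllipsoidPair K E.1 E.2 := by
  obtain ⟨hd1, Q, hQ⟩ := p.exists_sandwiches_ratio hcont hp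
  have hd : 0 < p.ratio := by linarith
  unfold IsDistanceEllipsoidPair
  rw [Seminorm.banachMazurDist_eq_ratio hp hK]
  generalize hρ : p.ratio = ρ at *
  have himage : ∀ T : V ≃ₗ[ℝ] V, T '' unitBall V = {x | ‖T.symm x‖ ^ 2 ≤ 1} := by
    intro T
    rw [← LinearEquiv.coe_toEquiv, Equiv.image_eq_preimage_symm]
    ext x
    simp [unitBall]
  obtain ⟨S, hS, hS'⟩ := hQ.exists_linearEquiv_le hd.le hp
  refine ⟨({x | Q x ≤ 1}, ρ • {x | Q x ≤ 1}), ⟨⟨S.symm, 0, ?_⟩,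
    ⟨S.symm.trans (LinearEquiv.smulOfNeZero ℝ V ρ hd.ne'), 0, ?_⟩, ⟨0, by simp⟩, ?_, ?_⟩, ?_⟩
  · simp [himage, hS]
  · have h1 : ⇑(S.symm.trans (LinearEquiv.smulOfNeZero ℝ V ρ hd.ne')) =
        (fun x => ρ • x) ∘ S.symm := by
      ext x
      simp
    rw [h1, Set.image_comp, himage, zero_vadd, Set.image_smul]
    simp [hS]
  · intro x hx
    refine (hK x).2 ?_
    have h1 : Q x ≤ 1 := hx
    have h2 := (hQ x).1
    nlinarith
  · intro x hx
    have h1 := (hK x).1 hx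
    have h2 := (hS' x).2
    refine ⟨ρ⁻¹ • x, ?_, by simp [smul_smul, hd.ne']⟩
    simp only [Set.mem_ofPred_eq]
    have h3 : ‖S x‖ ≤ ρ := by nlinarith
    rw [QuadraticMap.map_smul, hS, smul_eq_mul, ← mul_inv, inv_mul_le_iff₀ (by positivity)]
    nlinarith [norm_nonneg (S x)]
  · rintro ⟨E₁, E₂⟩ h
    obtain ⟨⟨T, c, hE₁⟩, -, ⟨t, hE₂⟩, hin, hout⟩ := h
    dsimp only at hE₁ hE₂ hin hout
    subst hE₁ hE₂
    have hin' : ∀ b, ‖b‖ ≤ 1 → p (c + T b) ≤ 1 := by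
      intro b hb
      exact (hK _).1 (hin ⟨T b, ⟨b, by simpa [unitBall] using hb, rfl⟩, rfl⟩)
    have hout' : ∀ x, p x ≤ 1 → ‖T.symm x - T.symm (t + ρ • c)‖ ≤ ρ := by
      intro x hx
      obtain ⟨_, ⟨_, ⟨_, ⟨b, hb, rfl⟩, rfl⟩, rfl⟩, h⟩ := hout ((hK x).2 hx)
      simp only [vadd_eq_add] at h
      have hb' : ‖b‖ ≤ 1 := by simpa [unitBall] using hb
      have : T.symm x - T.symm (t + ρ • c) = ρ • b := by
        rw [← h]
        simp
      rw [this, norm_smul, Real.norm_of_nonneg hd.le]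
      nlinarith
    have hlow : ∀ x, p x ^ 2 ≤ ‖T.symm x‖ ^ 2 := by
      intro x
      have := Seminorm.sq_le_norm_symm_sq (p := p) (r := 1) T (fun b hb => ?_) x
      · simpa using this
      have e1 := hin' b hb
      have e2 := hin' (-b) (by rwa [norm_neg])
      have e3 : (2 : ℝ) • T b = (c + T b) - (c + T (-b)) := by
        rw [map_neg]
        module
      have e4 := map_sub_le_add p (c + T b) (c + T (-b))
      rw [← e3, map_smul_eq_mul, Real.norm_of_nonneg zero_le_two] at e4
      nlinarith [apply_nonneg p (T b)]
    -- The outer center is `t + ρ • c`. The parallelogram law for `x` and `-x` gains its squared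
    -- length, which minimality of `ρ` forces to vanish.
    have hup : ∀ x, ‖T.symm x‖ ^ 2 ≤ (ρ ^ 2 - ‖T.symm (t + ρ • c)‖ ^ 2) * p x ^ 2 := by
      refine Seminorm.norm_symm_sq_le hp T fun x hx => ?_
      have e1 := hout' x hx
      have e2 := hout' (-x) (by rwa [map_neg_eq_map])
      rw [map_neg, ← norm_neg, neg_sub, sub_neg_eq_add, add_comm] at e2
      have e3 := parallelogram_law_with_norm ℝ (T.symm x) (T.symm (t + ρ • c))
      nlinarith [norm_nonneg (T.symm x - T.symm (t + ρ • c)),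
        norm_nonneg (T.symm x + T.symm (t + ρ • c))]
    have hsand : p.Sandwiches (ρ ^ 2 - ‖T.symm (t + ρ • c)‖ ^ 2)
        ((normSqForm V).comp (T.symm : V →ₗ[ℝ] V)) := fun x => by
      simpa only [QuadraticMap.comp_apply, normSqForm_apply] using ⟨hlow x, hup x⟩
    have hcenter : t + ρ • c = 0 := by
      have e1 := hsand.ratio_sq_le hp
      rw [hρ] at e1
      have e2 : ‖T.symm (t + ρ • c)‖ ^ 2 = 0 := le_antisymm (by linarith) (sq_nonneg _)
      rwa [sq_eq_zero_iff, norm_eq_zero, LinearEquiv.map_eq_zero_iff] at e2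
    rw [hcenter, map_zero, norm_zero, zero_pow two_ne_zero, sub_zero] at hsand
    have hc0 : c = 0 := Seminorm.eq_zero_of_translate_mem huniq T hsand hin'
    have ht0 : t = 0 := by simpa [hc0] using hcenter
    have hQT : ∀ x, ‖T.symm x‖ ^ 2 = Q x := by
      intro x
      rw [huniq _ _ hQ hsand]
      simp
    simp [hc0, ht0, himage, hQT]

/-! ### Minimal subspace and the main theorem -/

/-- Among the subspaces to which `p` restricts with the same ratio, one of least dimension has a
unique optimal form. -/
theorem Seminorm.exists_submodule_forall_sandwiches_eq [Nontrivial V] {p : Seminorm ℝ V}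
    (hc : Continuous p) (hp : ∀ x, p x = 0 → x = 0) :
    ∃ U : Submodule ℝ V, Nontrivial U ∧ (p.comp U.subtype).ratio = p.ratio ∧
      ∀ Q₁ Q₂, (p.comp U.subtype).Sandwiches ((p.comp U.subtype).ratio ^ 2) Q₁ →
        (p.comp U.subtype).Sandwiches ((p.comp U.subtype).ratio ^ 2) Q₂ → Q₁ = Q₂ := by
  have htop : (p.comp (⊤ : Submodule ℝ V).subtype).ratio = p.ratio :=
    p.ratio_comp_linearEquiv Submodule.topEquiv
  obtain ⟨U, hU, hmin⟩ := (measure fun U : Submodule ℝ V => Module.finrank ℝ U).wf.has_min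
    {U : Submodule ℝ V | (p.comp U.subtype).ratio = p.ratio} ⟨⊤, htop⟩
  have hU' : (p.comp U.subtype).ratio = p.ratio := hU
  have hnt : Nontrivial U := by
    by_contra h
    rw [not_nontrivial_iff_subsingleton] at h
    have := (p.exists_sandwiches_ratio hc hp).1
    rw [← hU', Seminorm.ratio_of_subsingleton] at this
    linarith
  refine ⟨U, hnt, hU', fun Q₁ Q₂ h₁ h₂ => ?_⟩
  by_contra hne
  obtain ⟨W, hW, hWr⟩ := h₁.exists_submodule_ratio_eq
    (show Continuous (p.comp U.subtype) from hc.comp continuous_subtype_val) (fun x hx => Subtype.ext (hp x hx)) h₂ hne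
  refine hmin (W.map U.subtype) ?_ ?_
  · have h := (p.comp (W.map U.subtype).subtype).ratio_comp_linearEquiv
      (Submodule.equivSubtypeMap U W)
    exact h.symm.trans (hWr.trans hU')
  · change Module.finrank ℝ (W.map U.subtype) < Module.finrank ℝ U
    rw [← (Submodule.equivSubtypeMap U W).finrank_eq]
    exact Submodule.finrank_lt hW

end

theorem theorem2p6 (n : ℕ) (hn : 1 ≤ n) (K : ConvexBody (EuclideanSpace ℝ (Fin n)))
    (hint : (interior (K : Set (EuclideanSpace ℝ (Fin n)))).Nonempty)
    (hsymm : -(K : Set (EuclideanSpace ℝ (Fin n))) = (K : Set (EuclideanSpace ℝ (Fin n)))) :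
    ∃ U : Submodule ℝ (EuclideanSpace ℝ (Fin n)),
      banachMazurDist (subspaceSection (K : Set (EuclideanSpace ℝ (Fin n))) U)
          (subspaceSection (unitBall (EuclideanSpace ℝ (Fin n))) U) =
        banachMazurDist (K : Set (EuclideanSpace ℝ (Fin n)))
          (unitBall (EuclideanSpace ℝ (Fin n))) ∧
      ∃! E : Set U × Set U,
        IsDistanceEllipsoidPair (subspaceSection (K : Set (EuclideanSpace ℝ (Fin n))) U)
          E.1 E.2 := by
  have : Nontrivial (EuclideanSpace ℝ (Fin n)) := by
    have : Nonempty (Fin n) := ⟨⟨0, hn⟩⟩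
    infer_instance
  obtain ⟨p, hc, hp, hK⟩ := K.exists_seminorm hint hsymm
  obtain ⟨U, hnt, hU, huniq⟩ := Seminorm.exists_submodule_forall_sandwiches_eq hc hp
  have hcU : Continuous (p.comp U.subtype) := hc.comp continuous_subtype_val
  have hpU : ∀ x, p.comp U.subtype x = 0 → x = 0 := fun x hx => Subtype.ext (hp x hx)
  have hKU : ∀ x, x ∈ subspaceSection (K : Set (EuclideanSpace ℝ (Fin n))) U ↔
      p.comp U.subtype x ≤ 1 := fun x => hK x
  have hball : subspaceSection (unitBall (EuclideanSpace ℝ (Fin n))) U = unitBall U := by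
    ext x
    simp [subspaceSection, unitBall]
  refine ⟨U, ?_, Seminorm.existsUnique_isDistanceEllipsoidPair hcU hpU huniq hKU⟩
  rw [hball, Seminorm.banachMazurDist_eq_ratio hpU hKU, hU,
    Seminorm.banachMazurDist_eq_ratio hp hK]
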